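/- Let $n\ge 0$, let $W(A_n)$ be the Coxeter group of type $A_n$ with generators $\sigma_1,\dots,\sigma_n$ ($\sigma_i\sigma_{i+1}$ of order $3$, $\sigma_i\sigma_j$ of order $2$ for $|i-j|>1$) and length function $\ell$. For $w\in W(A_n)$ let $\mathscr L(w)=\{\sigma_i : \ell(\sigma_i w)<\ell(w)\}$ and $\mathscr R(w)=\{\sigma_i : \ell(w\sigma_i)<\ell(w)\}$ be its left and right descent sets. Call $w$ fully commutative if any two reduced expressions of $w$ can be transformed into each other using only commutation relations $\sigma_i\sigma_j=\sigma_j\sigma_i$, $|i-j|>1$. For $1\le i\le j\le n$ put $[i,j]=\sigma_i\sigma_{i+1}\cdots\sigma_j$. (1) Let $w=[i_1,j_1][i_2,j_2]\cdots[i_p,j_p]$ with $p\ge 0$, $n\ge i_1>\dots>i_p\ge 1$, $n\ge j_1>\dots>j_p\ge 1$ and $i_t\le j_t$ for $1\le t\le p$ (by a known theorem of Stembridge, these are the canonical forms of the fully commutative elements of $W(A_n)$). Then $$\mathscr L(w)=\{\sigma_{i_1}\}\cup\{\sigma_{i_k} : 2\le k\le p,\ i_k<i_{k-1}-1\},\qquad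 \mathscr R(w)=\{\sigma_{j_p}\}\cup\{\sigma_{j_k} : 1\le k\le p-1,\ j_k>j_{k+1}+1\},$$ both sets being empty if $p=0$. (2) A non-crossing diagram on $n+1$ strings joins the dots of a top row $1,\dots,n+1$ and of a bottom row $1',\dots,(n+1)'$ of a rectangle in pairs, without crossings; the joins are called arrows. The concatenation $D_1*D_2$ is obtained by placing $D_2$ below $D_1$ and deleting the circles that arise. Let $E_i$ be the diagram with arrows $(i,i+1)$, $(i',(i+1)')$ and $(k,k')$ for $k\ne i,i+1$. For a fully commutative $w$ with reduced expression $w=\sigma_{k_1}\cdots\sigma_{k_r}$ let $\mathcal D(w)=E_{k_1}*\cdots*E_{k_r}$, the identity diagram (arrows $(k,k')$ for all $k$) if $r=0$; this is a non-crossing diagram and does not depend on the reduced expression. Then $$\mathscr L(w)=\{\sigma_i : (i,i+1)\text{ is an arrow of }\mathcal D(w)\},\qquad \mathscr R(w)=\{\sigma_i : (i',(i+1)')\text{ is an arrow of }\mathcal D(w)\}.$$ -/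

import Mathlib

namespace FCDiagram

/-! ### Fully commutative elements and descent sets of a Coxeter system -/

section Coxeter

variable {B : Type*} {M : CoxeterMatrix B} {W : Type*} [Group W]

/-- One application of a commutation relation `s t = t s` (where `m_{st} = 2`) to a word. -/
inductive CommutationStep (M : CoxeterMatrix B) : List B → List B → Prop
  | swap (l r : List B) (s t : B) (h : M s t = 2) :
      CommutationStep M (l ++ s :: t :: r) (l ++ t :: s :: r)

/-- `w` is fully commutative: one passes from any reduced expression of `w` to any other
by commutation relations only. -/
def IsFullyCommutative (cs : CoxeterSystem M W) (w : W) : Prop :=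
  ∀ ω ω' : List B, cs.IsReduced ω → cs.IsReduced ω' → cs.wordProd ω = w → cs.wordProd ω' = w →
    Relation.ReflTransGen (CommutationStep M) ω ω'

/-- The left descent set of `w`, as a set of (indices of) generators. -/
def leftDescents (cs : CoxeterSystem M W) (w : W) : Set B := {s | cs.IsLeftDescent w s}

/-- The right descent set of `w`, as a set of (indices of) generators. -/
def rightDescents (cs : CoxeterSystem M W) (w : W) : Set B := {s | cs.IsRightDescent w s}

end Coxeter

/-! ### Canonical forms in type `A_n`

The generator `σ_k`, `1 ≤ k ≤ n`, of `W(A_n)` is the simple reflection with index `k - 1 : Fin n`. -/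

/-- The word `[i, j] = σ_i σ_{i+1} ⋯ σ_j`. -/
def segment {n : ℕ} (i j : Fin n) : List (Fin n) :=
  (List.finRange n).filter fun k => i ≤ k ∧ k ≤ j

/-- The word `[i_1, j_1] [i_2, j_2] ⋯ [i_p, j_p]`. -/
def canonicalWord {n p : ℕ} (i j : Fin p → Fin n) : List (Fin n) :=
  (List.ofFn fun t => segment (i t) (j t)).flatten

/-- Standard `p`-pairs: `i_1 > ⋯ > i_p`, `j_1 > ⋯ > j_p` and `i_t ≤ j_t` for all `t`
(which forces `p ≤ n`). -/
structure IsStandard {n p : ℕ} (i j : Fin p → Fin n) : Prop where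
  anti_left : StrictAnti i
  anti_right : StrictAnti j
  le : ∀ t, i t ≤ j t

/-! ### Diagrams on `n + 1` strings -/

/-- The dots: a top row `1 < ⋯ < n+1` followed, in the total order,
by a bottom row `1' < ⋯ < (n+1)'`. -/
abbrev Dot (n : ℕ) : Type := Lex (Fin (n + 1) ⊕ Fin (n + 1))

/-- The `k`-th dot of the top row. -/
def top {n : ℕ} (k : Fin (n + 1)) : Dot n := toLex (Sum.inl k)

/-- The `k`-th dot of the bottom row. -/
def bot {n : ℕ} (k : Fin (n + 1)) : Dot n := toLex (Sum.inr k)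

/-- A diagram, as the set of its arrows `(x, y)`. -/
abbrev Arrows (n : ℕ) : Type := Set (Dot n × Dot n)

/-- The rank of a dot when one runs around the boundary of the rectangle: along the top row from
left to right, then along the bottom row from right to left. -/
def boundaryRank {n : ℕ} (d : Dot n) : ℕ :=
  Sum.elim (fun k : Fin (n + 1) => (k : ℕ)) (fun k : Fin (n + 1) => 2 * n + 1 - (k : ℕ)) (ofLex d)

/-- `r` lies strictly between the ranks of the two endpoints of the arrow `a`. -/
def RankBetween {n : ℕ} (a : Dot n × Dot n) (r : ℕ) : Prop :=
  min (boundaryRank a.1) (boundaryRank a.2) < r ∧ r < max (boundaryRank a.1) (boundaryRank a.2)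

/-- Non-crossing diagrams: arrows `(x, y)` satisfy `x < y`, each dot is an endpoint of exactly one
arrow, and no two arrows with four distinct endpoints cross, i.e. the endpoints of the second are
never separated, on the boundary of the rectangle, by those of the first. -/
structure IsNonCrossingDiagram {n : ℕ} (D : Arrows n) : Prop where
  lt : ∀ a ∈ D, a.1 < a.2
  existsUnique : ∀ d : Dot n, ∃! a, a ∈ D ∧ (a.1 = d ∨ a.2 = d)
  nonCrossing : ∀ a ∈ D, ∀ b ∈ D, a ≠ b →
    (RankBetween a (boundaryRank b.1) ↔ RankBetween a (boundaryRank b.2))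

/-- The identity diagram: arrows `(k, k')`. -/
def identity (n : ℕ) : Arrows n := {a | ∃ k, a = (top k, bot k)}

/-- The diagram `E_i`: arrows `(i, i+1)`, `(i', (i+1)')` and `(k, k')` for `k ≠ i, i+1`. -/
def E {n : ℕ} (i : Fin n) : Arrows n :=
  {(top i.castSucc, top i.succ), (bot i.castSucc, bot i.succ)} ∪
    {a | ∃ k, k ≠ i.castSucc ∧ k ≠ i.succ ∧ a = (top k, bot k)}

/-- Places the two rows of a diagram on the rows `r` and `r'` of a stack of three rows of dots. -/
def place {n : ℕ} (r r' : Fin 3) (d : Dot n) : Fin 3 × Fin (n + 1) :=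
  Sum.elim (fun k => (r, k)) (fun k => (r', k)) (ofLex d)

/-- The joins in the stack with `D₁` drawn between rows `0` and `1`, and `D₂` below it, between
rows `1` and `2`. -/
def StackJoin {n : ℕ} (D₁ D₂ : Arrows n) (u v : Fin 3 × Fin (n + 1)) : Prop :=
  (∃ a ∈ D₁, u = place 0 1 a.1 ∧ v = place 0 1 a.2) ∨
    (∃ a ∈ D₂, u = place 1 2 a.1 ∧ v = place 1 2 a.2)

/-- The concatenation `D₁ ∗ D₂`, with `D₂` placed below `D₁`: two dots of the outer rows are joined
when they are connected in the stack. Circles are deleted. -/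
def concat {n : ℕ} (D₁ D₂ : Arrows n) : Arrows n :=
  {a | a.1 < a.2 ∧ Relation.EqvGen (StackJoin D₁ D₂) (place 0 2 a.1) (place 0 2 a.2)}

/-- `E_{k_1} ∗ E_{k_2} ∗ ⋯ ∗ E_{k_r}`, from top to bottom, for a word `k_1 k_2 ⋯ k_r`. -/
def wordDiagram {n : ℕ} (ω : List (Fin n)) : Arrows n :=
  ω.foldr (fun i D => concat (E i) D) (identity n)

/-- The set `AD` of the arrows in the top row. -/
def topArrows {n : ℕ} (D : Arrows n) : Arrows n :=
  {a | a ∈ D ∧ ∃ x y, a = (top x, top y)}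

/-- The set `BD` of the arrows in the bottom row. -/
def bottomArrows {n : ℕ} (D : Arrows n) : Arrows n :=
  {a | a ∈ D ∧ ∃ x y, a = (bot x, bot y)}

/-- The diagram `𝒟(w)` of a fully commutative element `w` of `W(A_n)`: the concatenation of the
diagrams `E_k` along a reduced expression of `w`. -/
noncomputable def diagram {n : ℕ} {W : Type*} [Group W]
    (cs : CoxeterSystem (CoxeterMatrix.A n) W) (w : W) : Arrows n :=
  wordDiagram (cs.exists_isReduced w).choose

end FCDiagram

/-!
A word is *alternating* if between two consecutive occurrences of a letter `k` both `k - 1` and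
`k + 1` occur. Canonical words are alternating, and so are the reduced words of a fully commutative
element, since otherwise commutations would produce a factor `k (k ± 1) k`.

For an alternating word `ω`, the order of the first occurrences of neighbouring letters decides
everything. The inverse of the permutation of `ω` moves the point `a` to the right if and only if
the letter `a` of `ω` comes before `a - 1`, so each letter of `ω` adds `2`, the most it can, to the
total displacement `∑ |w⁻¹ a - a|`. Hence `ω` is reduced, and `s` is a left descent if and only if
the first `s` comes before all letters `s ± 1`. In the same way, an arrow `(a, b)` of the top row
of the diagram of `ω` forces the letter `a` to come before `a - 1` and the letter `b - 1` before
`b`, so that `(s, s + 1)` is an arrow under the same condition on `s`. Reversing words exchanges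
left and right descents, and the two rows of the diagram.
-/

namespace FCDiagram

/-! ### Order of first occurrences in a word -/

section Precedes

variable {α β : Type*}

/-- The letter `a` occurs in the word `ω`, and no `b` occurs before the first `a`. -/
def Precedes : List α → α → α → Prop
  | [], _, _ => False
  | k :: ω, a, b => k = a ∨ (k ≠ b ∧ Precedes ω a b)

@[simp] theorem not_precedes_nil (a b : α) : ¬ Precedes [] a b := id

@[simp] theorem precedes_cons {k a b : α} {ω : List α} :
    Precedes (k :: ω) a b ↔ k = a ∨ (k ≠ b ∧ Precedes ω a b) := Iff.rfl

theorem Precedes.mem {ω : List α} {a b : α} (h : Precedes ω a b) : a ∈ ω := by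
  induction ω with
  | nil => exact h.elim
  | cons k ω ih => grind [precedes_cons]

theorem precedes_or_precedes_of_mem {ω : List α} {a : α} (h : a ∈ ω) (b : α) :
    Precedes ω a b ∨ Precedes ω b a := by
  induction ω with
  | nil => simp at h
  | cons k ω ih => grind [precedes_cons]

theorem precedes_append {x y : List α} {a b : α} :
    Precedes (x ++ y) a b ↔ Precedes x a b ∨ (a ∉ x ∧ b ∉ x ∧ Precedes y a b) := by
  induction x with
  | nil => simp
  | cons k x ih => grind [precedes_cons]

theorem precedes_append_of_notMem {x y : List α} {a b : α} (ha : a ∉ x) :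
    Precedes (x ++ y) a b ↔ b ∉ x ∧ Precedes y a b := by
  rw [precedes_append]
  exact ⟨fun h => (h.resolve_left fun hx => ha hx.mem).2, fun h => .inr ⟨ha, h⟩⟩

theorem precedes_iff_exists_append {ω : List α} {a b : α} :
    Precedes ω a b ↔ ∃ v x, ω = v ++ a :: x ∧ a ∉ v ∧ b ∉ v := by
  constructor
  · intro h
    induction ω with
    | nil => exact h.elim
    | cons k ω ih =>
      by_cases hk : k = a
      · exact ⟨[], ω, by simp [hk]⟩
      · obtain ⟨hb, h⟩ := h.resolve_left hk
        obtain ⟨v, x, rfl, hv⟩ := ih h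
        exact ⟨k :: v, x, rfl, by grind⟩
  · rintro ⟨v, x, rfl, ha, hb⟩
    simp [precedes_append_of_notMem ha, hb]

theorem precedes_map {f : α → β} (hf : Function.Injective f) {ω : List α} {a b : α} :
    Precedes (ω.map f) (f a) (f b) ↔ Precedes ω a b := by
  induction ω with
  | nil => simp
  | cons k ω ih => simp [ih, hf.eq_iff]

theorem precedes_iff_of_pairwise_lt [LinearOrder α] {x : List α} (hx : x.Pairwise (· < ·))
    {a b : α} : Precedes x a b ↔ a ∈ x ∧ (b ∈ x → a ≤ b) := by
  induction x with
  | nil => simp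
  | cons k x ih =>
    rw [List.pairwise_cons] at hx
    have := ih hx.2
    have := hx.1 a
    have := hx.1 b
    grind [precedes_cons]

theorem precedes_flatten_ofFn {p : ℕ} {L : Fin p → List α} {a b : α} :
    Precedes (List.ofFn L).flatten a b ↔
      ∃ t, Precedes (L t) a b ∧ ∀ u < t, a ∉ L u ∧ b ∉ L u := by
  induction p with
  | zero => simp
  | succ p ih =>
    rw [List.ofFn_succ, List.flatten_cons, precedes_append, ih, Fin.exists_fin_succ]
    simp only [Fin.forall_fin_succ, Fin.not_lt_zero, Fin.succ_pos, Fin.succ_lt_succ_iff]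
    grind

end Precedes

/-! ### Alternating words -/

section Alternating

/-- Between two consecutive occurrences of `k`, both neighbours `k + 1` and `k - 1` occur. -/
def IsAlternating (ω : List ℤ) : Prop :=
  ∀ (u v x : List ℤ) (k : ℤ), ω = u ++ k :: (v ++ k :: x) → k ∉ v → k + 1 ∈ v ∧ k - 1 ∈ v

theorem isAlternating_nil : IsAlternating [] := fun u v x k h => by simp at h

theorem isAlternating_cons {k : ℤ} {ω : List ℤ} :
    IsAlternating (k :: ω) ↔
      IsAlternating ω ∧ ¬ Precedes ω k (k + 1) ∧ ¬ Precedes ω k (k - 1) := by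
  simp only [precedes_iff_exists_append]
  constructor
  · refine fun h => ⟨fun u v x m e => h (k :: u) v x m (by simp [e]), ?_, ?_⟩
    · rintro ⟨v, x, rfl, hk, hv⟩
      exact hv (h [] v x k rfl hk).1
    · rintro ⟨v, x, rfl, hk, hv⟩
      exact hv (h [] v x k rfl hk).2
  · rintro ⟨h, h_add, h_sub⟩ u v x m e hm
    cases u with
    | cons a u =>
      obtain ⟨-, rfl⟩ := List.cons.inj e
      exact h u v x m rfl hm
    | nil =>
      obtain ⟨rfl, rfl⟩ := List.cons.inj e
      exact ⟨by_contra fun hv => h_add ⟨v, x, rfl, hm, hv⟩,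
        by_contra fun hv => h_sub ⟨v, x, rfl, hm, hv⟩⟩

theorem IsAlternating.of_append_right {u ω : List ℤ} (h : IsAlternating (u ++ ω)) :
    IsAlternating ω :=
  fun u' v x k e => h (u ++ u') v x k (by rw [e, List.append_assoc])

theorem IsAlternating.reverse {ω : List ℤ} (h : IsAlternating ω) : IsAlternating ω.reverse := by
  intro u v x k e hk
  have e' : ω = x.reverse ++ k :: (v.reverse ++ k :: u.reverse) := by
    rw [← List.reverse_reverse ω, e]
    simp
  simpa using h _ _ _ k e' (by simpa using hk)

theorem IsAlternating.append {x y : List ℤ} (hy : IsAlternating y)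
    (h : ∀ u k v, x = u ++ k :: v →
      ¬ Precedes (v ++ y) k (k + 1) ∧ ¬ Precedes (v ++ y) k (k - 1)) :
    IsAlternating (x ++ y) := by
  induction x with
  | nil => exact hy
  | cons k x ih =>
    rw [List.cons_append, isAlternating_cons]
    exact ⟨ih fun u m v e => h (k :: u) m v (by simp [e]), h [] k x rfl⟩

/-- The letter `s` occurs in the word `ω`, and the first `s` comes before all letters `s ± 1`; in
type `A` this says that the first `s` can be moved to the front of `ω` by commutations. -/
def IsInitialLetter (ω : List ℤ) (s : ℤ) : Prop :=
  Precedes ω s (s + 1) ∧ Precedes ω s (s - 1)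

theorem isInitialLetter_map_sub_left {c s : ℤ} {ω : List ℤ} :
    IsInitialLetter (ω.map (c - ·)) (c - s) ↔ IsInitialLetter ω s := by
  have hc : Function.Injective (c - · : ℤ → ℤ) := sub_right_injective
  rw [IsInitialLetter, IsInitialLetter, show c - s + 1 = c - (s - 1) by ring,
    show c - s - 1 = c - (s + 1) by ring, precedes_map hc, precedes_map hc, and_comm]

/-- The word in the integers underlying a word in the generators `0, …, n - 1` of type `A_n`.
Passing to integers makes `k - 1` and `k + 1` meaningful for every letter `k`. -/
def intWord {n : ℕ} (ω : List (Fin n)) : List ℤ := ω.map fun k : Fin n => ((k : ℕ) : ℤ)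

@[simp] theorem intWord_nil {n : ℕ} : intWord ([] : List (Fin n)) = [] := rfl

@[simp] theorem intWord_cons {n : ℕ} (k : Fin n) (ω : List (Fin n)) :
    intWord (k :: ω) = (k : ℤ) :: intWord ω := rfl

theorem intWord_append {n : ℕ} (ω ω' : List (Fin n)) :
    intWord (ω ++ ω') = intWord ω ++ intWord ω' := List.map_append

theorem intWord_reverse {n : ℕ} (ω : List (Fin n)) :
    intWord ω.reverse = (intWord ω).reverse := List.map_reverse

theorem intWord_map_rev {n : ℕ} (ω : List (Fin n)) :
    intWord (ω.map Fin.rev) = (intWord ω).map ((n - 1 : ℤ) - ·) := by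
  simp only [intWord, List.map_map]
  refine List.map_congr_left fun k _ => ?_
  simp only [Function.comp, Fin.val_rev]
  omega

theorem exists_append_of_precedes_intWord {n : ℕ} {ω : List (Fin n)} {a b : ℤ}
    (h : Precedes (intWord ω) a b) :
    ∃ (v x : List (Fin n)) (k : Fin n), ω = v ++ k :: x ∧ (k : ℤ) = a ∧
      a ∉ intWord v ∧ b ∉ intWord v := by
  obtain ⟨v, x, e, ha, hb⟩ := precedes_iff_exists_append.1 h
  obtain ⟨v, y, rfl, rfl, hy⟩ := List.map_eq_append_iff.1 e
  obtain ⟨k, x, rfl, rfl, -⟩ := List.map_eq_cons_iff.1 hy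
  exact ⟨v, x, k, rfl, rfl, ha, hb⟩

end Alternating

/-! ### Canonical words -/

section CanonicalWord

variable {n p : ℕ}

theorem mem_intWord_segment {i j : Fin n} {a : ℤ} :
    a ∈ intWord (segment i j) ↔ (i : ℤ) ≤ a ∧ a ≤ (j : ℤ) := by
  simp only [intWord, segment, List.mem_map, List.mem_filter, List.mem_finRange, true_and,
    decide_eq_true_eq, Fin.le_def]
  constructor
  · rintro ⟨k, hk, rfl⟩
    omega
  · rintro ⟨hi, hj⟩
    exact ⟨⟨a.toNat, by omega⟩, by simp only; omega, by simp only; omega⟩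

theorem pairwise_lt_intWord_segment (i j : Fin n) :
    (intWord (segment i j)).Pairwise (· < ·) := by
  rw [intWord, List.pairwise_map]
  exact ((List.sortedLT_finRange n).pairwise.filter _).imp fun h => by simpa using h

theorem mem_iff_of_intWord_segment_eq_append {i j : Fin n} {u v : List ℤ} {k a : ℤ}
    (h : intWord (segment i j) = u ++ k :: v) : a ∈ v ↔ k < a ∧ a ≤ (j : ℤ) := by
  have hsorted := pairwise_lt_intWord_segment i j
  have hk : k ∈ intWord (segment i j) := by simp [h]
  have ha := mem_intWord_segment (i := i) (j := j) (a := a)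
  rw [mem_intWord_segment] at hk
  rw [h, List.pairwise_append, List.pairwise_cons] at hsorted
  rw [h, List.mem_append, List.mem_cons] at ha
  have := hsorted.2.1.1 a
  have := fun hau : a ∈ u => hsorted.2.2 a hau k (by simp)
  grind

theorem intWord_canonicalWord (i j : Fin p → Fin n) :
    intWord (canonicalWord i j) = (List.ofFn fun t => intWord (segment (i t) (j t))).flatten := by
  simp only [intWord, canonicalWord, List.map_flatten, List.map_ofFn, Function.comp_def]

theorem canonicalWord_succ (i j : Fin (p + 1) → Fin n) : canonicalWord i j =
    segment (i 0) (j 0) ++ canonicalWord (fun t => i t.succ) (fun t => j t.succ) := by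
  rw [canonicalWord, List.ofFn_succ, List.flatten_cons, canonicalWord]

theorem segment_reverse (i j : Fin n) :
    (segment i j).reverse = (segment j.rev i.rev).map Fin.rev := by
  rw [segment, segment, ← List.filter_reverse, List.finRange_reverse, List.filter_map]
  congr 1
  refine List.filter_congr fun k _ => ?_
  simp only [Function.comp, Fin.le_rev_iff, Fin.rev_le_iff, and_comm]

theorem canonicalWord_reverse (i j : Fin p → Fin n) :
    (canonicalWord i j).reverse =
      (canonicalWord (fun t => (j t.rev).rev) (fun t => (i t.rev).rev)).map Fin.rev := by
  have reverse_ofFn (f : Fin p → List (Fin n)) :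
      (List.ofFn f).reverse = List.ofFn fun t => f t.rev := by
    simp only [List.ofFn_eq_map, ← List.map_reverse, List.finRange_reverse, List.map_map,
      Function.comp_def]
  rw [canonicalWord, canonicalWord, List.reverse_flatten, List.map_flatten, List.map_ofFn,
    List.map_ofFn, reverse_ofFn]
  simp only [Function.comp_def, segment_reverse]

namespace IsStandard

theorem tail {i j : Fin (p + 1) → Fin n} (h : IsStandard i j) :
    IsStandard (fun t => i t.succ) (fun t => j t.succ) where
  anti_left := h.anti_left.comp_strictMono Fin.strictMono_succ
  anti_right := h.anti_right.comp_strictMono Fin.strictMono_succ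
  le _ := h.le _

variable {i j : Fin p → Fin n} (h : IsStandard i j)
include h

theorem rev : IsStandard (fun t => (j t.rev).rev) (fun t => (i t.rev).rev) where
  anti_left _ _ hab := Fin.rev_lt_rev.2 (h.anti_right (Fin.rev_lt_rev.2 hab))
  anti_right _ _ hab := Fin.rev_lt_rev.2 (h.anti_left (Fin.rev_lt_rev.2 hab))
  le _ := Fin.rev_le_rev.2 (h.le _)

theorem precedes_sub_one_iff {a : ℤ} :
    Precedes (intWord (canonicalWord i j)) a (a - 1) ↔ ∃ t, (i t : ℤ) = a := by
  rw [intWord_canonicalWord, precedes_flatten_ofFn]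
  simp only [precedes_iff_of_pairwise_lt (pairwise_lt_intWord_segment _ _), mem_intWord_segment]
  constructor
  · rintro ⟨t, ht, -⟩
    exact ⟨t, by omega⟩
  · rintro ⟨t, rfl⟩
    have := Fin.le_def.1 (h.le t)
    refine ⟨t, by omega, fun u hu => ?_⟩
    have := Fin.lt_def.1 (h.anti_left hu)
    omega

theorem precedes_add_one_iff {t : Fin p} :
    Precedes (intWord (canonicalWord i j)) (i t) (i t + 1) ↔
      ∀ u < t, (i u : ℤ) ≠ i t + 1 := by
  rw [intWord_canonicalWord, precedes_flatten_ofFn]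
  simp only [precedes_iff_of_pairwise_lt (pairwise_lt_intWord_segment _ _), mem_intWord_segment]
  constructor
  · rintro ⟨s, hs, hs_first⟩ u hut
    have := Fin.lt_def.1 (h.anti_left hut)
    have := Fin.le_def.1 (h.le u)
    rcases lt_or_ge u s with hus | hsu
    · have := hs_first u hus
      omega
    · have := Fin.le_def.1 (h.anti_left.antitone hsu)
      omega
  · intro hne
    have := Fin.le_def.1 (h.le t)
    refine ⟨t, by omega, fun u hu => ?_⟩
    have := Fin.lt_def.1 (h.anti_left hu)
    have := hne u hu
    omega

omit h in
theorem isAlternating {i j : Fin p → Fin n} (h : IsStandard i j) :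
    IsAlternating (intWord (canonicalWord i j)) := by
  induction p with
  | zero => simpa [canonicalWord] using isAlternating_nil
  | succ p ih =>
    rw [canonicalWord_succ, intWord_append]
    refine (ih h.tail).append fun u k v huv => ?_
    have hk : k ∈ intWord (segment (i 0) (j 0)) := by simp [huv]
    have mem_v {a : ℤ} := mem_iff_of_intWord_segment_eq_append huv (a := a)
    rw [mem_intWord_segment] at hk
    rw [precedes_append_of_notMem (by simp [mem_v]), precedes_append_of_notMem (by simp [mem_v])]
    constructor
    · rintro ⟨hv, hk_tail⟩
      replace hk_tail := hk_tail.mem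
      rw [intWord_canonicalWord, List.mem_flatten] at hk_tail
      obtain ⟨_, ht, hkt⟩ := hk_tail
      obtain ⟨t, rfl⟩ := (List.mem_ofFn' _ _).1 ht
      rw [mem_intWord_segment] at hkt
      have := Fin.lt_def.1 (h.anti_right t.succ_pos)
      rw [mem_v] at hv
      omega
    · rintro ⟨-, hk_tail⟩
      obtain ⟨t, ht⟩ := h.tail.precedes_sub_one_iff.1 hk_tail
      have := Fin.lt_def.1 (h.anti_left t.succ_pos)
      omega

theorem isInitialLetter_iff {s : Fin n} :
    IsInitialLetter (intWord (canonicalWord i j)) s ↔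
      s ∈ {s | ∃ k : Fin p, (k : ℕ) = 0 ∧ s = i k} ∪
        {s | ∃ k l : Fin p, (k : ℕ) = (l : ℕ) + 1 ∧
          ((i k : ℕ) : ℤ) < ((i l : ℕ) : ℤ) - 1 ∧ s = i k} := by
  rw [IsInitialLetter, h.precedes_sub_one_iff]
  simp only [Set.mem_union, Set.mem_ofPred_eq]
  constructor
  · rintro ⟨hs, t, ht⟩
    obtain rfl : i t = s := by ext; exact_mod_cast ht
    rw [h.precedes_add_one_iff] at hs
    rcases Nat.eq_zero_or_pos t with ht0 | ht0
    · exact .inl ⟨t, ht0, rfl⟩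
    · let l : Fin p := ⟨t - 1, by omega⟩
      have hlt : l < t := Fin.lt_def.2 (by simp only [l]; omega)
      have := hs l hlt
      have := Fin.lt_def.1 (h.anti_left hlt)
      exact .inr ⟨t, l, by simp only [l]; omega, by omega, rfl⟩
  · rintro (⟨t, ht, rfl⟩ | ⟨t, l, htl, hil, rfl⟩)
    · refine ⟨h.precedes_add_one_iff.2 fun u hu => ?_, t, rfl⟩
      have := Fin.lt_def.1 hu
      omega
    · refine ⟨h.precedes_add_one_iff.2 fun u hu => ?_, t, rfl⟩
      have hul : u ≤ l := Fin.le_def.2 (by have := Fin.lt_def.1 hu; omega)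
      have := Fin.le_def.1 (h.anti_left.antitone hul)
      omega

theorem isInitialLetter_reverse_iff {s : Fin n} :
    IsInitialLetter (intWord (canonicalWord i j).reverse) s ↔
      s ∈ {s | ∃ k : Fin p, (k : ℕ) + 1 = p ∧ s = j k} ∪
        {s | ∃ k l : Fin p, (l : ℕ) = (k : ℕ) + 1 ∧
          ((j l : ℕ) : ℤ) + 1 < ((j k : ℕ) : ℤ) ∧ s = j k} := by
  have hs : (s : ℤ) = n - 1 - (s.rev : ℕ) := by
    rw [Fin.val_rev]
    omega
  rw [canonicalWord_reverse, intWord_map_rev, hs, isInitialLetter_map_sub_left,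
    h.rev.isInitialLetter_iff]
  simp only [Set.mem_union, Set.mem_ofPred_eq, Fin.rev_inj]
  refine or_congr (Fin.revPerm.exists_congr fun k => ?_)
    (Fin.revPerm.exists_congr fun k => Fin.revPerm.exists_congr fun l => ?_)
  · simp only [Fin.revPerm_apply, Fin.val_rev]
    exact and_congr_left' (by omega)
  · simp only [Fin.revPerm_apply, Fin.val_rev]
    exact and_congr (by omega) (and_congr_left' (by omega))

end IsStandard

end CanonicalWord

/-! ### Commutation classes of words -/

section Commutation

variable {B : Type*} {M : CoxeterMatrix B} {ω ω' : List B}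

/-- The words `ω` and `ω'` are connected by commutation relations. Commutation steps are
reversible, so this is an equivalence relation. -/
abbrev CommutationEquiv (M : CoxeterMatrix B) (ω ω' : List B) : Prop :=
  Relation.ReflTransGen (CommutationStep M) ω ω'

instance : Std.Symm (CommutationStep M) where
  symm := by
    rintro _ _ ⟨l, r, s, t, h⟩
    exact .swap l r t s (M.symmetric s t ▸ h)

theorem CommutationStep.append_left (h : CommutationStep M ω ω') (u : List B) :
    CommutationStep M (u ++ ω) (u ++ ω') := by
  obtain ⟨l, r, s, t, h⟩ := h
  rw [← List.append_assoc, ← List.append_assoc]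
  exact .swap (u ++ l) r s t h

theorem CommutationStep.perm (h : CommutationStep M ω ω') : ω.Perm ω' := by
  obtain ⟨l, r, s, t, -⟩ := h
  exact (List.Perm.swap _ _ _).append_left l

namespace CommutationEquiv

theorem symm (h : CommutationEquiv M ω ω') : CommutationEquiv M ω' ω :=
  Relation.ReflTransGen.stdSymm.symm _ _ h

theorem append_left (h : CommutationEquiv M ω ω') (u : List B) :
    CommutationEquiv M (u ++ ω) (u ++ ω') :=
  Relation.ReflTransGen.lift (u ++ ·) (fun _ _ hstep => hstep.append_left u) _ _ h

theorem perm (h : CommutationEquiv M ω ω') : ω.Perm ω' := by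
  induction h with
  | refl => exact .refl _
  | tail _ hstep ih => exact ih.trans hstep.perm

end CommutationEquiv

theorem commutationEquiv_append_cons {u x : List B} {s : B} (h : ∀ t ∈ u, M t s = 2) :
    CommutationEquiv M (u ++ s :: x) (s :: (u ++ x)) := by
  induction u with
  | nil => exact .refl
  | cons t u ih =>
    rw [List.forall_mem_cons] at h
    exact ((ih h.2).append_left [t]).tail (.swap [] (u ++ x) t s h.1)

/-- No word that is connected to `ω` by commutations has a factor `k j k` with `m_{jk} = 3`. -/
def IsBraidFree (M : CoxeterMatrix B) (ω : List B) : Prop :=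
  ∀ (u x : List B) (j k : B), M j k = 3 → ¬ CommutationEquiv M ω (u ++ k :: j :: k :: x)

theorem IsBraidFree.of_cons {k : B} (h : IsBraidFree M (k :: ω)) : IsBraidFree M ω :=
  fun u x j m hjm e => h (k :: u) x j m hjm (e.append_left [k])

variable {W : Type*} [Group W] (cs : CoxeterSystem M W)

theorem simple_mul_comm {s t : B} (h : M s t = 2) :
    cs.simple s * cs.simple t = cs.simple t * cs.simple s := by
  simpa [CoxeterSystem.braidWord, CoxeterSystem.alternatingWord, h, M.symmetric t s,
    cs.wordProd_cons] using cs.wordProd_braidWord_eq s t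

theorem simple_mul_simple_mul_simple {j k : B} (h : M j k = 3) :
    cs.simple k * (cs.simple j * cs.simple k) = cs.simple j * (cs.simple k * cs.simple j) := by
  simpa [CoxeterSystem.braidWord, CoxeterSystem.alternatingWord, h, M.symmetric k j,
    cs.wordProd_cons] using cs.wordProd_braidWord_eq j k

theorem CommutationStep.wordProd_eq (h : CommutationStep M ω ω') :
    cs.wordProd ω = cs.wordProd ω' := by
  obtain ⟨l, r, s, t, h⟩ := h
  simp only [cs.wordProd_append, cs.wordProd_cons]
  rw [← mul_assoc (cs.simple s), simple_mul_comm cs h, mul_assoc]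

theorem CommutationEquiv.wordProd_eq (h : CommutationEquiv M ω ω') :
    cs.wordProd ω = cs.wordProd ω' := by
  induction h with
  | refl => rfl
  | tail _ hstep ih => rw [ih, hstep.wordProd_eq cs]

theorem CommutationEquiv.isReduced (h : CommutationEquiv M ω ω') (hω : cs.IsReduced ω) :
    cs.IsReduced ω' := by
  rw [CoxeterSystem.IsReduced, ← h.wordProd_eq cs, hω.eq, h.perm.length_eq]

theorem IsFullyCommutative.isBraidFree (hw : IsFullyCommutative cs (cs.wordProd ω))
    (hω : cs.IsReduced ω) : IsBraidFree M ω := by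
  classical
  intro u x j k hjk e
  have hprod : cs.wordProd (u ++ j :: k :: j :: x) = cs.wordProd (u ++ k :: j :: k :: x) := by
    have := congrArg (cs.wordProd u * · * cs.wordProd x) (simple_mul_simple_mul_simple cs hjk)
    simpa only [cs.wordProd_append, cs.wordProd_cons, mul_assoc] using this.symm
  have hred : cs.IsReduced (u ++ j :: k :: j :: x) := by
    rw [CoxeterSystem.IsReduced, hprod, (e.isReduced cs hω).eq]
    simp
  have hne : j ≠ k := by
    rintro rfl
    simp at hjk
  -- The two words have different numbers of letters `k`.
  have hcount := CommutationEquiv.perm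
    (e.symm.trans (hw _ _ hω hred rfl (hprod.trans (e.wordProd_eq cs).symm)))
  simpa [List.count_append, hne] using hcount.count_eq k

theorem isLeftDescent_of_commutationEquiv_cons {s : B} (hω : cs.IsReduced ω)
    (h : CommutationEquiv M ω (s :: ω')) : cs.IsLeftDescent (cs.wordProd ω) s := by
  have := cs.length_wordProd_le ω'
  rw [CoxeterSystem.IsLeftDescent, hω.eq, h.perm.length_eq, h.wordProd_eq cs, cs.wordProd_cons,
    cs.simple_mul_simple_cancel_left, List.length_cons]
  omega

end Commutation

/-! ### Fully commutative elements of type `A` -/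

section TypeA

variable {n : ℕ}

theorem coxeterMatrix_A_eq_two_iff {i j : Fin n} : CoxeterMatrix.A n i j = 2 ↔
    (i : ℕ) ≠ j ∧ (j : ℕ) + 1 ≠ i ∧ (i : ℕ) + 1 ≠ j := by
  simp only [CoxeterMatrix.A, Matrix.of_apply, Fin.ext_iff]
  grind

theorem coxeterMatrix_A_eq_three_iff {i j : Fin n} : CoxeterMatrix.A n i j = 3 ↔
    (j : ℕ) + 1 = i ∨ (i : ℕ) + 1 = j := by
  simp only [CoxeterMatrix.A, Matrix.of_apply, Fin.ext_iff]
  grind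

theorem commutationEquiv_append_cons_of_notMem_intWord {u x : List (Fin n)} {s : Fin n}
    (h : (s : ℤ) ∉ intWord u) (h_add : (s + 1 : ℤ) ∉ intWord u) (h_sub : (s - 1 : ℤ) ∉ intWord u) :
    CommutationEquiv (CoxeterMatrix.A n) (u ++ s :: x) (s :: (u ++ x)) := by
  refine commutationEquiv_append_cons fun t ht => coxeterMatrix_A_eq_two_iff.2 ?_
  have ht : (t : ℤ) ∈ intWord u := List.mem_map_of_mem ht
  grind

theorem exists_commutationEquiv_cons_of_isInitialLetter {ω : List (Fin n)} {s : Fin n}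
    (h : IsInitialLetter (intWord ω) s) :
    ∃ ω', CommutationEquiv (CoxeterMatrix.A n) ω (s :: ω') := by
  obtain ⟨u, x, k, rfl, hk, hu, hu_add⟩ := exists_append_of_precedes_intWord h.1
  obtain rfl : k = s := by ext; exact_mod_cast hk
  have hu_sub := h.2
  rw [intWord_append, precedes_append_of_notMem hu] at hu_sub
  exact ⟨u ++ x, commutationEquiv_append_cons_of_notMem_intWord hu hu_add hu_sub.1⟩

theorem isInitialLetter_iff_of_eq_one_or {ω : List ℤ} {k e : ℤ} (he : e = 1 ∨ e = -1) :
    IsInitialLetter ω k ↔ Precedes ω k (k + e) ∧ Precedes ω k (k - e) := by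
  rcases he with rfl | rfl
  · rfl
  · rw [IsInitialLetter, and_comm, sub_neg_eq_add, ← sub_eq_add_neg]

theorem IsAlternating.not_isBraidFree_cons {ω : List (Fin n)} {k : Fin n} {e : ℤ}
    (he : e = 1 ∨ e = -1) (hω : IsAlternating (intWord ω))
    (h_add : Precedes (intWord ω) k (k + e)) (h_sub : Precedes (intWord ω) (k - e) k) :
    ¬ IsBraidFree (CoxeterMatrix.A n) (k :: ω) := by
  obtain ⟨u, y, j, rfl, hj, hju, hku⟩ := exists_append_of_precedes_intWord h_sub
  rw [intWord_append, intWord_cons] at hω h_add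
  rw [precedes_append_of_notMem hku, precedes_cons] at h_add
  have h_add_y : Precedes (intWord y) k (k + e) := (h_add.2.resolve_left (by omega)).2
  have hy : ¬ Precedes (intWord y) j k := by
    have := (isAlternating_cons.1 hω.of_append_right).2
    rcases he with rfl | rfl <;> grind
  have hk_initial : IsInitialLetter (intWord y) k :=
    (isInitialLetter_iff_of_eq_one_or he).2
      ⟨h_add_y, hj ▸ (precedes_or_precedes_of_mem h_add_y.mem _).resolve_right hy⟩
  obtain ⟨x, hx⟩ := exists_commutationEquiv_cons_of_isInitialLetter hk_initial
  have hku_neighbours : (k + 1 : ℤ) ∉ intWord u ∧ (k - 1 : ℤ) ∉ intWord u := by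
    rcases he with rfl | rfl <;> grind
  refine fun hfree => hfree u x j k (coxeterMatrix_A_eq_three_iff.2 (by omega)) ?_
  calc CommutationEquiv (CoxeterMatrix.A n) (k :: (u ++ j :: y)) (k :: (u ++ j :: k :: x)) := by
        simpa using hx.append_left (k :: (u ++ [j]))
    CommutationEquiv (CoxeterMatrix.A n) _ (u ++ k :: j :: k :: x) :=
        (commutationEquiv_append_cons_of_notMem_intWord hku hku_neighbours.1
          hku_neighbours.2).symm

variable {W : Type*} [Group W] (cs : CoxeterSystem (CoxeterMatrix.A n) W)

theorem not_isReduced_cons_of_isInitialLetter {ω : List (Fin n)} {s : Fin n}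
    (h : IsInitialLetter (intWord ω) s) : ¬ cs.IsReduced (s :: ω) := by
  intro hred
  obtain ⟨ω', e⟩ := exists_commutationEquiv_cons_of_isInitialLetter h
  have hdescent := isLeftDescent_of_commutationEquiv_cons cs (hred.drop 1) e
  rw [CoxeterSystem.IsLeftDescent, List.drop_one, List.tail_cons, ← cs.wordProd_cons, hred.eq,
    List.length_cons] at hdescent
  have := cs.length_wordProd_le ω
  omega

theorem IsBraidFree.isAlternating {ω : List (Fin n)} (hfree : IsBraidFree (CoxeterMatrix.A n) ω)
    (hω : cs.IsReduced ω) : IsAlternating (intWord ω) := by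
  induction ω with
  | nil => exact isAlternating_nil
  | cons k ω ih =>
    have hω_alt := ih hfree.of_cons (hω.drop 1)
    have not_precedes {e : ℤ} (he : e = 1 ∨ e = -1) : ¬ Precedes (intWord ω) k (k + e) := by
      intro h_add
      rcases precedes_or_precedes_of_mem h_add.mem (k - e) with h_sub | h_sub
      · exact not_isReduced_cons_of_isInitialLetter cs
          ((isInitialLetter_iff_of_eq_one_or he).2 ⟨h_add, h_sub⟩) hω
      · exact hω_alt.not_isBraidFree_cons he h_add h_sub hfree
    exact isAlternating_cons.2 ⟨hω_alt, not_precedes (.inl rfl), not_precedes (.inr rfl)⟩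

end TypeA

/-! ### The permutation representation -/

section Permutation

variable {n : ℕ}

/-- The transposition exchanging `k` and `k + 1`, the image of `σ_{k + 1}` in the symmetric
group. -/
def adjacentSwap (k : Fin n) : Equiv.Perm (Fin (n + 1)) := Equiv.swap k.castSucc k.succ

theorem adjacentSwap_castSucc (k : Fin n) : adjacentSwap k k.castSucc = k.succ :=
  Equiv.swap_apply_left _ _

theorem adjacentSwap_succ (k : Fin n) : adjacentSwap k k.succ = k.castSucc :=
  Equiv.swap_apply_right _ _

theorem adjacentSwap_of_ne {k : Fin n} {a : Fin (n + 1)} (h : a ≠ k.castSucc) (h' : a ≠ k.succ) :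
    adjacentSwap k a = a :=
  Equiv.swap_apply_of_ne_of_ne h h'

theorem adjacentSwap_mul_self (k : Fin n) : adjacentSwap k * adjacentSwap k = 1 :=
  Equiv.swap_mul_self _ _

theorem adjacentSwap_inv (k : Fin n) : (adjacentSwap k)⁻¹ = adjacentSwap k :=
  Equiv.swap_inv _ _

theorem adjacentSwap_mul_pow_three {i j : Fin n} (h : (j : ℕ) + 1 = i ∨ (i : ℕ) + 1 = j) :
    (adjacentSwap i * adjacentSwap j) ^ 3 = 1 := by
  have pow_three {a b c : Fin (n + 1)} (hab : a ≠ b) (hac : a ≠ c) (hbc : b ≠ c) :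
      (Equiv.swap a b * Equiv.swap a c) ^ 3 = 1 := by
    rw [← (Equiv.Perm.isThreeCycle_swap_mul_swap_same hab hac hbc).orderOf, pow_orderOf_eq_one]
  rcases h with h | h
  · have e : i.castSucc = j.succ := by ext; simp [← h]
    rw [adjacentSwap, adjacentSwap, e, Equiv.swap_comm j.castSucc]
    apply pow_three <;> simp [Fin.ext_iff] <;> omega
  · have e : i.succ = j.castSucc := by ext; simp [← h]
    rw [adjacentSwap, adjacentSwap, e, Equiv.swap_comm i.castSucc]
    apply pow_three <;> simp [Fin.ext_iff] <;> omega

theorem adjacentSwap_commute {i j : Fin n} (hij : (i : ℕ) ≠ j) (hji : (j : ℕ) + 1 ≠ i)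
    (hij' : (i : ℕ) + 1 ≠ j) : Commute (adjacentSwap i) (adjacentSwap j) := by
  refine Equiv.Perm.Disjoint.commute fun a => ?_
  by_cases ha : a = i.castSucc ∨ a = i.succ
  · right
    refine adjacentSwap_of_ne ?_ ?_ <;> rcases ha with rfl | rfl <;>
      simp only [ne_eq, Fin.ext_iff, Fin.val_castSucc, Fin.val_succ] <;> omega
  · rw [not_or] at ha
    exact .inl (adjacentSwap_of_ne ha.1 ha.2)

theorem isLiftable_adjacentSwap :
    (CoxeterMatrix.A n).IsLiftable (adjacentSwap : Fin n → Equiv.Perm (Fin (n + 1))) := by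
  intro i j
  rcases eq_or_ne i j with rfl | hij
  · rw [CoxeterMatrix.diagonal, pow_one, adjacentSwap_mul_self]
  by_cases h : (j : ℕ) + 1 = i ∨ (i : ℕ) + 1 = j
  · rw [coxeterMatrix_A_eq_three_iff.2 h, adjacentSwap_mul_pow_three h]
  · rw [not_or] at h
    have hij := Fin.val_ne_of_ne hij
    rw [coxeterMatrix_A_eq_two_iff.2 ⟨hij, h.1, h.2⟩, (adjacentSwap_commute hij h.1 h.2).mul_pow,
      pow_two, pow_two, adjacentSwap_mul_self, adjacentSwap_mul_self, one_mul]

/-- The total distance by which the permutation `g` moves the points. -/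
def displacement (g : Equiv.Perm (Fin (n + 1))) : ℤ := ∑ a, |(g a : ℤ) - a|

theorem displacement_one : displacement (1 : Equiv.Perm (Fin (n + 1))) = 0 := by
  simp [displacement]

theorem displacement_mul_adjacentSwap (g : Equiv.Perm (Fin (n + 1))) (k : Fin n) :
    displacement (g * adjacentSwap k) = displacement g +
      (if g k.succ < k.succ then -1 else 1) + (if k.castSucc < g k.castSucc then -1 else 1) := by
  rw [add_assoc, ← sub_eq_iff_eq_add', displacement, displacement, ← Finset.sum_sub_distrib,
    Fintype.sum_eq_add k.castSucc k.succ (by simp [Fin.ext_iff])]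
  · simp only [Equiv.Perm.mul_apply, adjacentSwap_castSucc, adjacentSwap_succ, Fin.lt_def,
      Fin.val_castSucc, Fin.val_succ]
    grind
  · rintro a ⟨h, h'⟩
    rw [Equiv.Perm.mul_apply, adjacentSwap_of_ne h h', sub_self]

variable {W : Type*} [Group W] (cs : CoxeterSystem (CoxeterMatrix.A n) W)

/-- The inverse of the image of `w` in the symmetric group. The inverse is taken because it changes
by a transposition of positions, not of values, when `w` is multiplied on the left. -/
noncomputable def invPerm (w : W) : Equiv.Perm (Fin (n + 1)) :=
  (cs.lift ⟨adjacentSwap, isLiftable_adjacentSwap⟩ w)⁻¹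

theorem invPerm_one : invPerm cs 1 = 1 := by rw [invPerm, map_one, inv_one]

theorem invPerm_simple_mul (k : Fin n) (w : W) :
    invPerm cs (cs.simple k * w) = invPerm cs w * adjacentSwap k := by
  rw [invPerm, map_mul, mul_inv_rev, cs.lift_apply_simple, adjacentSwap_inv, invPerm]

theorem displacement_invPerm_le_two_mul_length (w : W) :
    displacement (invPerm cs w) ≤ 2 * cs.length w := by
  obtain ⟨ω, hω, rfl⟩ := cs.exists_isReduced w
  rw [hω.eq]
  clear hω
  induction ω with
  | nil => simp [invPerm_one, displacement_one]
  | cons k ω ih =>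
    rw [cs.wordProd_cons, invPerm_simple_mul, displacement_mul_adjacentSwap, List.length_cons]
    push_cast
    split_ifs <;> omega

namespace IsAlternating

variable {cs} {ω : List (Fin n)} (h : IsAlternating (intWord ω))
include h

theorem lt_invPerm_iff_and_invPerm_lt_iff (a : Fin (n + 1)) :
    (a < invPerm cs (cs.wordProd ω) a ↔ Precedes (intWord ω) a (a - 1)) ∧
      (invPerm cs (cs.wordProd ω) a < a ↔ Precedes (intWord ω) (a - 1) a) := by
  induction ω generalizing a with
  | nil => simp [invPerm_one]
  | cons k ω ih =>
    rw [intWord_cons, isAlternating_cons] at h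
    rw [cs.wordProd_cons, invPerm_simple_mul, Equiv.Perm.mul_apply, intWord_cons, precedes_cons,
      precedes_cons]
    by_cases hcast : a = k.castSucc
    · have := ih h.1 k.succ
      rw [hcast, adjacentSwap_castSucc]
      simp only [Fin.lt_def, Fin.val_castSucc, Fin.val_succ, Nat.cast_add, Nat.cast_one,
        add_sub_cancel_right] at this ⊢
      grind
    by_cases hsucc : a = k.succ
    · have := ih h.1 k.castSucc
      rw [hsucc, adjacentSwap_succ]
      simp only [Fin.lt_def, Fin.val_castSucc, Fin.val_succ, Nat.cast_add, Nat.cast_one,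
        add_sub_cancel_right] at this ⊢
      grind
    rw [adjacentSwap_of_ne hcast hsucc, (ih h.1 a).1, (ih h.1 a).2]
    rw [Fin.ext_iff, Fin.val_castSucc] at hcast
    rw [Fin.ext_iff, Fin.val_succ] at hsucc
    grind

open Classical in
theorem displacement_invPerm_simple_mul (k : Fin n) :
    displacement (invPerm cs (cs.simple k * cs.wordProd ω)) =
      displacement (invPerm cs (cs.wordProd ω)) +
        (if Precedes (intWord ω) k (k + 1) then -1 else 1) +
        (if Precedes (intWord ω) k (k - 1) then -1 else 1) := by
  rw [invPerm_simple_mul, displacement_mul_adjacentSwap]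
  simp only [(h.lt_invPerm_iff_and_invPerm_lt_iff _).1, (h.lt_invPerm_iff_and_invPerm_lt_iff _).2,
    Fin.val_castSucc, Fin.val_succ, Nat.cast_add, Nat.cast_one, add_sub_cancel_right]

theorem displacement_invPerm :
    displacement (invPerm cs (cs.wordProd ω)) = 2 * ω.length := by
  induction ω with
  | nil => simp [invPerm_one, displacement_one]
  | cons k ω ih =>
    rw [intWord_cons, isAlternating_cons] at h
    rw [cs.wordProd_cons, h.1.displacement_invPerm_simple_mul, ih h.1, if_neg h.2.1, if_neg h.2.2,
      List.length_cons]
    push_cast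
    ring

theorem isReduced : cs.IsReduced ω := by
  have hle := displacement_invPerm_le_two_mul_length cs (cs.wordProd ω)
  have := cs.length_wordProd_le ω
  rw [h.displacement_invPerm] at hle
  rw [CoxeterSystem.IsReduced]
  omega

theorem isLeftDescent_iff {s : Fin n} :
    cs.IsLeftDescent (cs.wordProd ω) s ↔ IsInitialLetter (intWord ω) s := by
  refine ⟨fun hs => ?_, fun hs => ?_⟩
  · have hle := displacement_invPerm_le_two_mul_length cs (cs.simple s * cs.wordProd ω)
    rw [CoxeterSystem.IsLeftDescent, h.isReduced.eq] at hs
    rw [h.displacement_invPerm_simple_mul, h.displacement_invPerm] at hle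
    by_contra hnot
    rw [IsInitialLetter, not_and_or] at hnot
    split_ifs at hle <;> grind
  · obtain ⟨ω', e⟩ := exists_commutationEquiv_cons_of_isInitialLetter hs
    exact isLeftDescent_of_commutationEquiv_cons cs h.isReduced e

theorem isRightDescent_iff {s : Fin n} :
    cs.IsRightDescent (cs.wordProd ω) s ↔ IsInitialLetter (intWord ω.reverse) s := by
  rw [← cs.isLeftDescent_inv_iff, ← cs.wordProd_reverse]
  exact isLeftDescent_iff (intWord_reverse ω ▸ h.reverse)

end IsAlternating

end Permutation

/-! ### Fixed-point-free involutions -/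

section Matching

variable {α : Type*}

/-- A perfect matching, encoded as the fixed-point-free involution sending each point to its
partner. -/
structure IsMatching (f : α → α) : Prop where
  involutive : Function.Involutive f
  ne : ∀ x, f x ≠ x

theorem equivalence_eq_or_apply_eq {f : α → α} (hf : Function.Involutive f) :
    Equivalence fun x y => x = y ∨ f x = y where
  refl _ := .inl rfl
  symm := by
    rintro x _ (rfl | rfl)
    · exact .inl rfl
    · exact .inr (hf x)
  trans := by
    rintro x _ _ (rfl | rfl) (rfl | rfl)
    · exact .inl rfl
    · exact .inr rfl
    · exact .inr rfl
    · exact .inl (hf x).symm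

variable [DecidableEq α]

/-- The matching obtained from `f` by joining `t` to `t'`, and the former partner of `t` to the
former partner of `t'`. -/
def rejoin (t t' : α) (f : α → α) (x : α) : α :=
  if x = t then t' else if x = t' then t else if f x = t then f t' else
    if f x = t' then f t else f x

variable {f : α → α} {t t' x : α}

theorem rejoin_left : rejoin t t' f t = t' := if_pos rfl

theorem rejoin_right : rejoin t t' f t' = t := by
  unfold rejoin
  grind

theorem rejoin_of_ne (ht : x ≠ t) (ht' : x ≠ t') (hft : f x ≠ t) (hft' : f x ≠ t') :
    rejoin t t' f x = f x := by
  simp only [rejoin, if_neg ht, if_neg ht', if_neg hft, if_neg hft']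

namespace IsMatching

theorem rejoin_partner_left (hf : IsMatching f) : rejoin t t' f (f t) = f t' := by
  have := hf.involutive t
  have := hf.ne t
  unfold rejoin
  grind

theorem rejoin_partner_right (hf : IsMatching f) : rejoin t t' f (f t') = f t := by
  have := hf.involutive t'
  have := hf.ne t'
  unfold rejoin
  grind

theorem rejoin (hf : IsMatching f) (h : t ≠ t') : IsMatching (rejoin t t' f) where
  involutive x := by
    have := hf.involutive x
    have := hf.involutive t
    have := hf.involutive t'
    have := hf.ne t
    have := hf.ne t'
    unfold FCDiagram.rejoin
    grind
  ne x := by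
    have := hf.involutive t
    have := hf.involutive t'
    have := hf.ne x
    unfold FCDiagram.rejoin
    grind

theorem rejoin_comm (hf : IsMatching f) {a a' b b' : α} (haa' : a ≠ a') (hbb' : b ≠ b')
    (hab : a ≠ b) (hab' : a ≠ b') (ha'b : a' ≠ b) (ha'b' : a' ≠ b') :
    FCDiagram.rejoin a a' (FCDiagram.rejoin b b' f) =
      FCDiagram.rejoin b b' (FCDiagram.rejoin a a' f) := by
  funext x
  have := hf.involutive x
  have := hf.involutive a
  have := hf.involutive a'
  have := hf.involutive b
  have := hf.involutive b'
  have := hf.ne x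
  have := hf.ne a
  have := hf.ne a'
  have := hf.ne b
  have := hf.ne b'
  unfold FCDiagram.rejoin
  grind (splits := 30)

theorem rejoin_partners (hf : IsMatching f) (h : f t ≠ t') :
    FCDiagram.rejoin (f t) (f t') f = FCDiagram.rejoin t t' f := by
  funext x
  have := hf.involutive x
  have := hf.involutive t
  have := hf.involutive t'
  have := hf.ne t
  have := hf.ne t'
  unfold FCDiagram.rejoin
  grind

end IsMatching

theorem rejoin_conj {σ : α → α} (hσ : Function.Involutive σ) (t t' : α) (f : α → α) :
    rejoin (σ t) (σ t') (fun x => σ (f (σ x))) = fun x => σ (rejoin t t' f (σ x)) := by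
  funext x
  simp only [rejoin, hσ.eq_iff, hσ _]
  split_ifs <;> simp_all

end Matching

/-! ### Diagrams as matchings of dots -/

section DiagramMatching

variable {n : ℕ}

theorem dot_cases (x : Dot n) : (∃ k, x = top k) ∨ ∃ k, x = bot k := by
  rcases h : ofLex x with k | k
  · exact .inl ⟨k, h⟩
  · exact .inr ⟨k, h⟩

@[simp] theorem top_inj {a b : Fin (n + 1)} : top a = top b ↔ a = b :=
  ⟨fun h => Sum.inl_injective h, congrArg top⟩

@[simp] theorem bot_inj {a b : Fin (n + 1)} : bot a = bot b ↔ a = b :=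
  ⟨fun h => Sum.inr_injective h, congrArg bot⟩

@[simp] theorem top_ne_bot {a b : Fin (n + 1)} : top a ≠ bot b := fun h => Sum.inl_ne_inr h

@[simp] theorem bot_ne_top {a b : Fin (n + 1)} : bot a ≠ top b := fun h => Sum.inr_ne_inl h

theorem top_castSucc_ne_top_succ (k : Fin n) : top k.castSucc ≠ top k.succ := by
  simp [Fin.ext_iff]

theorem top_lt_top {a b : Fin (n + 1)} : top a < top b ↔ a < b := Sum.Lex.inl_lt_inl_iff

theorem bot_lt_bot {a b : Fin (n + 1)} : bot a < bot b ↔ a < b := Sum.Lex.inr_lt_inr_iff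

theorem top_lt_bot {a b : Fin (n + 1)} : top a < bot b := Sum.Lex.inl_lt_inr _ _

/-- The diagram whose arrows join each dot to its partner under the matching `f`. -/
def arrows (f : Dot n → Dot n) : Arrows n := {a | a.1 < a.2 ∧ f a.1 = a.2}

/-- The exchange of the two rows, which is also the matching of the identity diagram. -/
def swapRows (x : Dot n) : Dot n := toLex (ofLex x).swap

@[simp] theorem swapRows_top (k : Fin (n + 1)) : swapRows (top k) = bot k := rfl

@[simp] theorem swapRows_bot (k : Fin (n + 1)) : swapRows (bot k) = top k := rfl

theorem swapRows_involutive : Function.Involutive (swapRows : Dot n → Dot n) := fun x => by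
  rcases dot_cases x with ⟨k, rfl⟩ | ⟨k, rfl⟩ <;> rfl

theorem isMatching_swapRows : IsMatching (swapRows : Dot n → Dot n) where
  involutive := swapRows_involutive
  ne x := by rcases dot_cases x with ⟨k, rfl⟩ | ⟨k, rfl⟩ <;> simp

theorem identity_eq_arrows : identity n = arrows swapRows := by
  ext ⟨x, y⟩
  simp only [identity, arrows, Set.mem_ofPred_eq, Prod.mk.injEq]
  constructor
  · rintro ⟨k, rfl, rfl⟩
    exact ⟨top_lt_bot, rfl⟩
  · rintro ⟨h, rfl⟩
    rcases dot_cases x with ⟨k, rfl⟩ | ⟨k, rfl⟩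
    · exact ⟨k, rfl, rfl⟩
    · exact absurd h top_lt_bot.not_gt

/-- The matching whose arrows form `wordDiagram ω`: placing `E k` on top of a diagram joins the
dots `k` and `k + 1` of its top row, and their former partners. -/
def wordMatching (ω : List (Fin n)) : Dot n → Dot n :=
  ω.foldr (fun k f => rejoin (top k.castSucc) (top k.succ) f) swapRows

@[simp] theorem wordMatching_nil : wordMatching ([] : List (Fin n)) = swapRows := rfl

@[simp] theorem wordMatching_cons (k : Fin n) (ω : List (Fin n)) :
    wordMatching (k :: ω) = rejoin (top k.castSucc) (top k.succ) (wordMatching ω) := rfl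

theorem isMatching_wordMatching (ω : List (Fin n)) : IsMatching (wordMatching ω) := by
  induction ω with
  | nil => exact isMatching_swapRows
  | cons k ω ih => exact ih.rejoin (top_castSucc_ne_top_succ k)

end DiagramMatching

/-! ### Concatenation with `E i` -/

section Concatenation

variable {n : ℕ} {f : Dot n → Dot n} {i : Fin n}

@[simp] theorem place_top (r r' : Fin 3) (k : Fin (n + 1)) : place r r' (top k) = (r, k) := rfl

@[simp] theorem place_bot (r r' : Fin 3) (k : Fin (n + 1)) : place r r' (bot k) = (r', k) := rfl

open Relation in
theorem eqvGen_stackJoin_place_outer_inner (D : Arrows n) {x : Dot n} (ht : x ≠ top i.castSucc)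
    (ht' : x ≠ top i.succ) : EqvGen (StackJoin (E i) D) (place 0 2 x) (place 1 2 x) := by
  rcases dot_cases x with ⟨k, rfl⟩ | ⟨k, rfl⟩
  · exact .rel _ _ (.inl ⟨(top k, bot k), .inr ⟨k, by simpa using ht, by simpa using ht', rfl⟩,
      rfl, rfl⟩)
  · exact .refl _

open Relation in
theorem eqvGen_stackJoin_place_inner (D : Arrows n) (hf : IsMatching f) (x : Dot n) :
    EqvGen (StackJoin D (arrows f)) (place 1 2 x) (place 1 2 (f x)) := by
  rcases lt_or_gt_of_ne (hf.ne x) with h | h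
  · exact .symm _ _ (.rel _ _ (.inr ⟨(f x, x), ⟨h, hf.involutive x⟩, rfl, rfl⟩))
  · exact .rel _ _ (.inr ⟨(x, f x), ⟨h, rfl⟩, rfl, rfl⟩)

open Relation in
theorem eqvGen_stackJoin_rejoin (hf : IsMatching f) (x : Dot n) :
    EqvGen (StackJoin (E i) (arrows f)) (place 0 2 x)
      (place 0 2 (rejoin (top i.castSucc) (top i.succ) f x)) := by
  let _ : Setoid (Fin 3 × Fin (n + 1)) := EqvGen.setoid (StackJoin (E i) (arrows f))
  set t : Dot n := top i.castSucc
  set t' : Dot n := top i.succ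
  have vertical {z} : z ≠ t → z ≠ t' → place 0 2 z ≈ place 1 2 z :=
    eqvGen_stackJoin_place_outer_inner _
  have lower (z) : place 1 2 z ≈ place 1 2 (f z) := eqvGen_stackJoin_place_inner _ hf z
  have cup : place 0 2 t ≈ place 0 2 t' :=
    .rel _ _ (.inl ⟨(top i.castSucc, top i.succ), .inl (.inl rfl), rfl, rfl⟩)
  have cap : place 1 2 t ≈ place 1 2 t' :=
    .rel _ _ (.inl ⟨(bot i.castSucc, bot i.succ), .inl (.inr rfl), rfl, rfl⟩)
  have partners {z z'} (h : place 1 2 z ≈ place 1 2 z') (hzt : f z ≠ t) (hzt' : f z ≠ t')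
      (hz't : f z' ≠ t) (hz't' : f z' ≠ t') : place 0 2 (f z) ≈ place 0 2 (f z') :=
    calc place 0 2 (f z) ≈ place 1 2 (f z) := vertical hzt hzt'
      _ ≈ place 1 2 z := Setoid.symm (lower z)
      _ ≈ place 1 2 z' := h
      _ ≈ place 1 2 (f z') := lower z'
      _ ≈ place 0 2 (f z') := Setoid.symm (vertical hz't hz't')
  change place 0 2 x ≈ place 0 2 (rejoin t t' f x)
  by_cases ht : x = t
  · rw [ht, rejoin_left]
    exact cup
  by_cases ht' : x = t'
  · rw [ht', rejoin_right]
    exact Setoid.symm cup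
  by_cases hft : f x = t
  · obtain rfl : f t = x := by rw [← hft, hf.involutive]
    rw [hf.rejoin_partner_left]
    exact partners cap ht ht' (mt hf.involutive.eq_iff.1 (Ne.symm ht')) (hf.ne t')
  by_cases hft' : f x = t'
  · obtain rfl : f t' = x := by rw [← hft', hf.involutive]
    rw [hf.rejoin_partner_right]
    exact partners (Setoid.symm cap) ht ht' (hf.ne t) (mt hf.involutive.eq_iff.1 (Ne.symm ht))
  rw [rejoin_of_ne ht ht' hft hft']
  calc place 0 2 x ≈ place 1 2 x := vertical ht ht'
    _ ≈ place 1 2 (f x) := lower x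
    _ ≈ place 0 2 (f x) := Setoid.symm (vertical hft hft')

/-- The retraction of the stack of `E i` on top of the diagram of `f` onto its outer rows: a dot of
the middle row follows the vertical line of `E i` through it, or, at `i` and `i + 1` where there is
none, its arrow in the lower diagram. -/
def outerDot (i : Fin n) (f : Dot n → Dot n) (u : Fin 3 × Fin (n + 1)) : Dot n :=
  if u.1 = 0 then top u.2
  else if u.1 = 1 then
    if top u.2 = top i.castSucc ∨ top u.2 = top i.succ then f (top u.2) else top u.2
  else bot u.2

theorem outerDot_place_outer (x : Dot n) : outerDot i f (place 0 2 x) = x := by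
  rcases dot_cases x with ⟨k, rfl⟩ | ⟨k, rfl⟩ <;> simp [outerDot]

theorem outerDot_place_inner (x : Dot n) : outerDot i f (place 1 2 x) =
    if x = top i.castSucc ∨ x = top i.succ then f x else x := by
  rcases dot_cases x with ⟨k, rfl⟩ | ⟨k, rfl⟩
  · rfl
  · simp [outerDot]

theorem outerDot_eq_or_rejoin_eq_of_stackJoin (hf : IsMatching f) {u v : Fin 3 × Fin (n + 1)}
    (h : StackJoin (E i) (arrows f) u v) : outerDot i f u = outerDot i f v ∨
      rejoin (top i.castSucc) (top i.succ) f (outerDot i f u) = outerDot i f v := by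
  rcases h with ⟨_, (rfl | rfl) | ⟨k, hk, hk', rfl⟩, rfl, rfl⟩ |
    ⟨⟨x, _⟩, ⟨-, rfl : f x = _⟩, rfl, rfl⟩
  · exact .inr rejoin_left
  · right
    simpa [outerDot] using hf.rejoin_partner_left
  · left
    simp [outerDot, hk, hk']
  · simp only [outerDot_place_inner]
    split_ifs with hx hfx hfx
    · right
      rcases hx with rfl | rfl
      · rw [hf.rejoin_partner_left, hfx.resolve_left (hf.ne _)]
      · rw [hf.rejoin_partner_right, hfx.resolve_right (hf.ne _)]
    · exact .inl rfl
    · exact .inl (hf.involutive x).symm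
    · rw [not_or] at hx hfx
      exact .inr (rejoin_of_ne hx.1 hx.2 hfx.1 hfx.2)

theorem rejoin_eq_of_eqvGen_stackJoin (hf : IsMatching f) {x y : Dot n} (hxy : x ≠ y)
    (h : Relation.EqvGen (StackJoin (E i) (arrows f)) (place 0 2 x) (place 0 2 y)) :
    rejoin (top i.castSucc) (top i.succ) f x = y := by
  have hequiv := (equivalence_eq_or_apply_eq
    (hf.rejoin (top_castSucc_ne_top_succ i)).involutive).comap (outerDot i f)
  have hconn := hequiv.eqvGen_iff.1
    (h.mono fun _ _ huv => outerDot_eq_or_rejoin_eq_of_stackJoin hf huv)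
  rw [Function.onFun, outerDot_place_outer, outerDot_place_outer] at hconn
  exact hconn.resolve_left hxy

theorem concat_E_arrows (hf : IsMatching f) :
    concat (E i) (arrows f) = arrows (rejoin (top i.castSucc) (top i.succ) f) := by
  ext ⟨x, y⟩
  refine and_congr_right fun hxy => ⟨rejoin_eq_of_eqvGen_stackJoin hf hxy.ne, ?_⟩
  rintro (rfl : rejoin _ _ f x = y)
  exact eqvGen_stackJoin_rejoin hf x

theorem wordDiagram_eq_arrows (ω : List (Fin n)) : wordDiagram ω = arrows (wordMatching ω) := by
  induction ω with
  | nil => exact identity_eq_arrows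
  | cons k ω ih =>
    change concat (E k) (wordDiagram ω) = _
    rw [ih, concat_E_arrows (isMatching_wordMatching ω), wordMatching_cons]

end Concatenation

/-! ### Planarity -/

section Planarity

variable {n : ℕ} {f : Dot n → Dot n} {t t' : Dot n}

@[simp] theorem boundaryRank_top (k : Fin (n + 1)) : boundaryRank (top k) = k := rfl

@[simp] theorem boundaryRank_bot (k : Fin (n + 1)) : boundaryRank (bot k) = 2 * n + 1 - k := rfl

theorem boundaryRank_injective : Function.Injective (boundaryRank : Dot n → ℕ) := by
  intro x y h
  rcases dot_cases x with ⟨k, rfl⟩ | ⟨k, rfl⟩ <;> rcases dot_cases y with ⟨l, rfl⟩ | ⟨l, rfl⟩ <;>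
    simp [Fin.ext_iff] at * <;> omega

/-- The join through `y` does not cross the join through `x`: it has both ends on the same side of
the latter, in the sense of `boundaryRank`. -/
def Uncrossed (f : Dot n → Dot n) (x y : Dot n) : Prop :=
  RankBetween (x, f x) (boundaryRank y) ↔ RankBetween (x, f x) (boundaryRank (f y))

/-- Planarity of a matching of the dots: distinct joins do not cross. -/
def IsPlanar (f : Dot n → Dot n) : Prop := ∀ x y, y ≠ x → y ≠ f x → Uncrossed f x y

theorem Uncrossed.symm (hf : Function.Involutive f) {x y : Dot n} (hyx : y ≠ x) (hyfx : y ≠ f x)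
    (h : Uncrossed f y x) : Uncrossed f x y := by
  have := boundaryRank_injective.ne hyx
  have := boundaryRank_injective.ne hyfx
  have := boundaryRank_injective.ne (hf.injective.ne hyx)
  have := boundaryRank_injective.ne (mt hf.eq_iff.1 hyfx)
  simp only [Uncrossed, RankBetween] at h ⊢
  omega

theorem rankBetween_iff_of_adjacent (hadj : boundaryRank t' = boundaryRank t + 1)
    {x x' : Dot n} (hxt : x ≠ t) (hxt' : x ≠ t') (hx't : x' ≠ t) (hx't' : x' ≠ t') :
    RankBetween (x, x') (boundaryRank t) ↔ RankBetween (x, x') (boundaryRank t') := by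
  have := boundaryRank_injective.ne hxt
  have := boundaryRank_injective.ne hxt'
  have := boundaryRank_injective.ne hx't
  have := boundaryRank_injective.ne hx't'
  simp only [RankBetween]
  omega

theorem isPlanar_swapRows : IsPlanar (swapRows : Dot n → Dot n) := by
  intro x y hyx hyx'
  rcases dot_cases x with ⟨k, rfl⟩ | ⟨k, rfl⟩ <;> rcases dot_cases y with ⟨l, rfl⟩ | ⟨l, rfl⟩ <;>
    simp [Uncrossed, RankBetween, Fin.ext_iff] at * <;> omega

theorem uncrossed_rejoin_of_eq_or_eq (hf : IsMatching f)
    (hadj : boundaryRank t' = boundaryRank t + 1) {x y : Dot n} (hy : y = t ∨ y = t')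
    (hyx : y ≠ x) (hygx : y ≠ rejoin t t' f x) : Uncrossed (rejoin t t' f) x y := by
  have hg : IsMatching (rejoin t t' f) := hf.rejoin (by rintro rfl; omega)
  have hgt : rejoin t t' f t = t' := rejoin_left
  have hgt' : rejoin t t' f t' = t := rejoin_right
  have hxt : x ≠ t := by grind
  have hxt' : x ≠ t' := by grind
  have hcup := rankBetween_iff_of_adjacent hadj hxt hxt'
    (by rwa [Ne, hg.involutive.eq_iff, hgt]) (by rwa [Ne, hg.involutive.eq_iff, hgt'])
  rcases hy with rfl | rfl
  · rwa [Uncrossed, hgt]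
  · rw [Uncrossed, hgt']
    exact hcup.symm

/-- The join through `x` is not affected by the rejoining; it separates neither `t` from `f t`, nor
`t` from `t'`, nor `t'` from `f t'`, hence not `f t` from `f t'` either. -/
theorem IsPlanar.uncrossed_rejoin (hp : IsPlanar f) (hf : IsMatching f)
    (hadj : boundaryRank t' = boundaryRank t + 1) {x y : Dot n} (hxt : x ≠ t) (hxt' : x ≠ t')
    (hfxt : f x ≠ t) (hfxt' : f x ≠ t') (hyx : y ≠ x) (hygx : y ≠ rejoin t t' f x) :
    Uncrossed (rejoin t t' f) x y := by
  unfold Uncrossed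
  rw [rejoin_of_ne hxt hxt' hfxt hfxt'] at hygx ⊢
  have cup : RankBetween (x, f x) (boundaryRank t) ↔ RankBetween (x, f x) (boundaryRank t') :=
    rankBetween_iff_of_adjacent hadj hxt hxt' hfxt hfxt'
  have left : Uncrossed f x t := hp x t hxt.symm hfxt.symm
  have right : Uncrossed f x t' := hp x t' hxt'.symm hfxt'.symm
  by_cases hyt : y = t
  · rwa [hyt, rejoin_left]
  by_cases hyt' : y = t'
  · rw [hyt', rejoin_right]
    exact cup.symm
  by_cases hyft : f y = t
  · obtain rfl : f t = y := by rw [← hyft, hf.involutive]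
    rw [hf.rejoin_partner_left]
    exact (Iff.symm left).trans (cup.trans right)
  by_cases hyft' : f y = t'
  · obtain rfl : f t' = y := by rw [← hyft', hf.involutive]
    rw [hf.rejoin_partner_right]
    exact (Iff.symm right).trans (cup.symm.trans left)
  rw [rejoin_of_ne hyt hyt' hyft hyft']
  exact hp x y hyx hygx

theorem IsPlanar.rejoin (hp : IsPlanar f) (hf : IsMatching f)
    (hadj : boundaryRank t' = boundaryRank t + 1) : IsPlanar (rejoin t t' f) := by
  intro x y hyx hygx
  have hg : IsMatching (FCDiagram.rejoin t t' f) := hf.rejoin (by rintro rfl; omega)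
  have hxgy : x ≠ FCDiagram.rejoin t t' f y := mt hg.involutive.eq_iff.2 hygx.symm
  by_cases hy : y = t ∨ y = t'
  · exact uncrossed_rejoin_of_eq_or_eq hf hadj hy hyx hygx
  by_cases hx : x = t ∨ x = t'
  · exact (uncrossed_rejoin_of_eq_or_eq hf hadj hx hyx.symm hxgy).symm hg.involutive hyx hygx
  rw [not_or] at hx hy
  by_cases hfx : f x ≠ t ∧ f x ≠ t'
  · exact hp.uncrossed_rejoin hf hadj hx.1 hx.2 hfx.1 hfx.2 hyx hygx
  by_cases hfy : f y ≠ t ∧ f y ≠ t'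
  · exact (hp.uncrossed_rejoin hf hadj hy.1 hy.2 hfy.1 hfy.2 hyx.symm hxgy).symm
      hg.involutive hyx hygx
  -- Now `x` and `y` are both former partners of `t` or `t'`, so they belong to the same join.
  have := hf.involutive x
  have := hf.involutive y
  have : FCDiagram.rejoin t t' f (f t) = f t' := hf.rejoin_partner_left
  have : FCDiagram.rejoin t t' f (f t') = f t := hf.rejoin_partner_right
  grind

theorem isPlanar_wordMatching (ω : List (Fin n)) : IsPlanar (wordMatching ω) := by
  induction ω with
  | nil => exact isPlanar_swapRows
  | cons k ω ih => exact ih.rejoin (isMatching_wordMatching ω) (by simp)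

theorem isNonCrossingDiagram_arrows (hf : IsMatching f) (hp : IsPlanar f) :
    IsNonCrossingDiagram (arrows f) where
  lt _ ha := ha.1
  existsUnique d := by
    rcases lt_or_gt_of_ne (hf.ne d) with h | h
    · refine ⟨(f d, d), ⟨⟨h, hf.involutive d⟩, .inr rfl⟩, ?_⟩
      rintro ⟨x, _⟩ ⟨⟨hx, rfl : f x = _⟩, rfl | rfl⟩
      · exact absurd h (lt_asymm hx)
      · rw [hf.involutive]
    · refine ⟨(d, f d), ⟨⟨h, rfl⟩, .inl rfl⟩, ?_⟩
      rintro ⟨x, _⟩ ⟨⟨hx, rfl : f x = _⟩, rfl | rfl⟩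
      · rfl
      · rw [hf.involutive] at h
        exact absurd h (lt_asymm hx)
  nonCrossing := by
    rintro ⟨x, _⟩ ⟨hx, rfl : f x = _⟩ ⟨y, _⟩ ⟨hy, rfl : f y = _⟩ hne
    refine hp x y ?_ ?_
    · rintro rfl
      exact hne rfl
    · rintro rfl
      rw [hf.involutive] at hy
      exact absurd hx hy.not_gt

theorem isNonCrossingDiagram_wordDiagram (ω : List (Fin n)) :
    IsNonCrossingDiagram (wordDiagram ω) := by
  rw [wordDiagram_eq_arrows]
  exact isNonCrossingDiagram_arrows (isMatching_wordMatching ω) (isPlanar_wordMatching ω)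

end Planarity

/-! ### Commutation and reversal -/

section WordMatching

variable {n : ℕ}

theorem CommutationStep.wordMatching_eq {ω ω' : List (Fin n)}
    (h : CommutationStep (CoxeterMatrix.A n) ω ω') : wordMatching ω = wordMatching ω' := by
  obtain ⟨l, r, s, t, h⟩ := h
  rw [coxeterMatrix_A_eq_two_iff] at h
  simp only [wordMatching, List.foldr_append, List.foldr_cons]
  congr 1
  apply (isMatching_wordMatching r).rejoin_comm <;> simp [Fin.ext_iff] <;> omega

theorem CommutationEquiv.wordMatching_eq {ω ω' : List (Fin n)}
    (h : CommutationEquiv (CoxeterMatrix.A n) ω ω') : wordMatching ω = wordMatching ω' := by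
  induction h with
  | refl => rfl
  | tail _ h ih => exact ih.trans h.wordMatching_eq

theorem wordMatching_append_singleton (ω : List (Fin n)) (k : Fin n) :
    wordMatching (ω ++ [k]) = rejoin (bot k.castSucc) (bot k.succ) (wordMatching ω) := by
  induction ω with
  | nil => exact (isMatching_swapRows.rejoin_partners (by simp)).symm
  | cons m ω ih =>
    rw [List.cons_append, wordMatching_cons, ih, wordMatching_cons]
    apply (isMatching_wordMatching ω).rejoin_comm <;> simp [Fin.ext_iff]

theorem wordMatching_reverse (ω : List (Fin n)) :
    wordMatching ω.reverse = fun x => swapRows (wordMatching ω (swapRows x)) := by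
  induction ω with
  | nil => exact funext fun x => (congrArg swapRows (swapRows_involutive x)).symm
  | cons k ω ih =>
    rw [List.reverse_cons, wordMatching_append_singleton, ih, wordMatching_cons,
      ← rejoin_conj swapRows_involutive, swapRows_top, swapRows_top]

end WordMatching

/-! ### Arrows of the outer rows -/

section OuterRows

variable {n : ℕ} {ω : List (Fin n)} {s : Fin n}

theorem IsAlternating.precedes_of_wordMatching_top (h : IsAlternating (intWord ω))
    {a b : Fin (n + 1)} (hab : wordMatching ω (top a) = top b) :
    (a < b → Precedes (intWord ω) (a : ℕ) ((a : ℕ) - 1)) ∧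
      (b < a → Precedes (intWord ω) ((a : ℕ) - 1) (a : ℕ)) := by
  induction ω generalizing a b with
  | nil => simp at hab
  | cons k ω ih =>
    rw [intWord_cons, isAlternating_cons] at h
    obtain ⟨hω, hk_add, hk_sub⟩ := h
    have hm := isMatching_wordMatching ω
    have castSucc_lt {c} (hc : wordMatching ω (top k.castSucc) = top c) : c < k.castSucc := by
      refine lt_of_le_of_ne (not_lt.1 fun hlt => hk_sub ((ih hω hc).1 hlt)) ?_
      rintro rfl
      exact hm.ne _ hc
    have lt_succ {c} (hc : wordMatching ω (top k.succ) = top c) : k.succ < c := by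
      refine lt_of_le_of_ne (not_lt.1 fun hlt => hk_add ?_) ?_
      · simpa using (ih hω hc).2 hlt
      · rintro rfl
        exact hm.ne _ hc
    rw [wordMatching_cons, rejoin] at hab
    simp only [intWord_cons, precedes_cons]
    split_ifs at hab with hak hak' hfak hfak'
    · obtain rfl := top_inj.1 hak
      obtain rfl := top_inj.1 hab
      exact ⟨fun _ => .inl rfl, fun hlt => absurd hlt k.castSucc_lt_succ.not_gt⟩
    · obtain rfl := top_inj.1 hak'
      obtain rfl := top_inj.1 hab
      exact ⟨fun hlt => absurd hlt k.castSucc_lt_succ.not_gt, fun _ => .inl (by simp)⟩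
    · have hlt := castSucc_lt (hm.involutive.eq_iff.1 hfak).symm
      have hlt' := lt_succ hab
      have hprec := (ih hω hfak).1 hlt
      simp only [Fin.lt_def, Fin.val_castSucc, Fin.val_succ] at hlt hlt' ⊢
      exact ⟨fun _ => .inr ⟨by omega, hprec⟩, fun _ => by omega⟩
    · have hlt := lt_succ (hm.involutive.eq_iff.1 hfak').symm
      have hlt' := castSucc_lt hab
      have hprec := (ih hω hfak').2 hlt
      simp only [Fin.lt_def, Fin.val_castSucc, Fin.val_succ] at hlt hlt' ⊢
      exact ⟨fun _ => by omega, fun _ => .inr ⟨by omega, hprec⟩⟩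
    · rw [top_inj, Fin.ext_iff, Fin.val_castSucc] at hak
      rw [top_inj, Fin.ext_iff, Fin.val_succ] at hak'
      exact ⟨fun hlt => .inr ⟨by omega, (ih hω hab).1 hlt⟩,
        fun hlt => .inr ⟨by omega, (ih hω hab).2 hlt⟩⟩

theorem wordMatching_top_of_isInitialLetter (hs : IsInitialLetter (intWord ω) s) :
    wordMatching ω (top s.castSucc) = top s.succ := by
  obtain ⟨ω', h⟩ := exists_commutationEquiv_cons_of_isInitialLetter hs
  rw [h.wordMatching_eq, wordMatching_cons, rejoin_left]

theorem IsAlternating.wordMatching_top_iff (h : IsAlternating (intWord ω)) :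
    wordMatching ω (top s.castSucc) = top s.succ ↔ IsInitialLetter (intWord ω) s := by
  refine ⟨fun hs => ?_, wordMatching_top_of_isInitialLetter⟩
  have hs' := ((isMatching_wordMatching ω).involutive.eq_iff.1 hs).symm
  have hsub := (h.precedes_of_wordMatching_top hs).1 (by simp [Fin.lt_def])
  have hadd := (h.precedes_of_wordMatching_top hs').2 (by simp [Fin.lt_def])
  simp only [Fin.val_castSucc, Fin.val_succ, Nat.cast_add, Nat.cast_one,
    add_sub_cancel_right] at hsub hadd
  exact ⟨hadd, hsub⟩

theorem IsAlternating.wordMatching_bot_iff (h : IsAlternating (intWord ω)) :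
    wordMatching ω (bot s.castSucc) = bot s.succ ↔ IsInitialLetter (intWord ω.reverse) s := by
  have hrev : IsAlternating (intWord ω.reverse) := by
    rw [intWord_reverse]
    exact h.reverse
  rw [← hrev.wordMatching_top_iff, wordMatching_reverse, swapRows_involutive.eq_iff,
    swapRows_top, swapRows_top]

theorem mem_topArrows_wordDiagram_iff :
    (top s.castSucc, top s.succ) ∈ topArrows (wordDiagram ω) ↔
      wordMatching ω (top s.castSucc) = top s.succ := by
  rw [wordDiagram_eq_arrows]
  exact ⟨fun h => h.1.2, fun h => ⟨⟨top_lt_top.2 s.castSucc_lt_succ, h⟩, _, _, rfl⟩⟩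

theorem mem_bottomArrows_wordDiagram_iff :
    (bot s.castSucc, bot s.succ) ∈ bottomArrows (wordDiagram ω) ↔
      wordMatching ω (bot s.castSucc) = bot s.succ := by
  rw [wordDiagram_eq_arrows]
  exact ⟨fun h => h.1.2, fun h => ⟨⟨bot_lt_bot.2 s.castSucc_lt_succ, h⟩, _, _, rfl⟩⟩

end OuterRows

/-! ### Descent sets -/

section Descents

variable {n : ℕ} {W : Type*} [Group W] {cs : CoxeterSystem (CoxeterMatrix.A n) W}

theorem IsStandard.leftDescents_eq {p : ℕ} {i j : Fin p → Fin n} (h : IsStandard i j) :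
    leftDescents cs (cs.wordProd (canonicalWord i j)) =
      {s | ∃ k : Fin p, (k : ℕ) = 0 ∧ s = i k} ∪
      {s | ∃ k l : Fin p, (k : ℕ) = (l : ℕ) + 1 ∧
        ((i k : ℕ) : ℤ) < ((i l : ℕ) : ℤ) - 1 ∧ s = i k} :=
  Set.ext fun _ => h.isAlternating.isLeftDescent_iff.trans h.isInitialLetter_iff

theorem IsStandard.rightDescents_eq {p : ℕ} {i j : Fin p → Fin n} (h : IsStandard i j) :
    rightDescents cs (cs.wordProd (canonicalWord i j)) =
      {s | ∃ k : Fin p, (k : ℕ) + 1 = p ∧ s = j k} ∪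
      {s | ∃ k l : Fin p, (l : ℕ) = (k : ℕ) + 1 ∧
        ((j l : ℕ) : ℤ) + 1 < ((j k : ℕ) : ℤ) ∧ s = j k} :=
  Set.ext fun _ => h.isAlternating.isRightDescent_iff.trans h.isInitialLetter_reverse_iff

variable {w : W} {ω : List (Fin n)}

theorem IsFullyCommutative.isAlternating (hw : IsFullyCommutative cs w) (hω : cs.IsReduced ω)
    (hprod : cs.wordProd ω = w) : IsAlternating (intWord ω) := by
  subst hprod
  exact (hw.isBraidFree cs hω).isAlternating cs hω

theorem IsFullyCommutative.wordDiagram_eq_diagram (hw : IsFullyCommutative cs w)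
    (hω : cs.IsReduced ω) (hprod : cs.wordProd ω = w) : wordDiagram ω = diagram cs w := by
  obtain ⟨hred, hw'⟩ := (cs.exists_isReduced w).choose_spec
  have hequiv : CommutationEquiv (CoxeterMatrix.A n) ω _ := hw _ _ hω hred hprod hw'.symm
  rw [diagram, wordDiagram_eq_arrows, wordDiagram_eq_arrows, hequiv.wordMatching_eq]

theorem IsFullyCommutative.leftDescents_eq (hw : IsFullyCommutative cs w) :
    leftDescents cs w =
      {s | (top s.castSucc, top s.succ) ∈ topArrows (diagram cs w)} := by
  obtain ⟨ω, hω, rfl⟩ := cs.exists_isReduced w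
  have halt := hw.isAlternating hω rfl
  ext s
  rw [← hw.wordDiagram_eq_diagram hω rfl, Set.mem_ofPred_eq, mem_topArrows_wordDiagram_iff,
    halt.wordMatching_top_iff]
  exact halt.isLeftDescent_iff

theorem IsFullyCommutative.rightDescents_eq (hw : IsFullyCommutative cs w) :
    rightDescents cs w =
      {s | (bot s.castSucc, bot s.succ) ∈ bottomArrows (diagram cs w)} := by
  obtain ⟨ω, hω, rfl⟩ := cs.exists_isReduced w
  have halt := hw.isAlternating hω rfl
  ext s
  rw [← hw.wordDiagram_eq_diagram hω rfl, Set.mem_ofPred_eq, mem_bottomArrows_wordDiagram_iff,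
    halt.wordMatching_bot_iff]
  exact halt.isRightDescent_iff

end Descents

end FCDiagram

theorem mainTheorem9 (n : ℕ) {W : Type*} [Group W]
    (cs : CoxeterSystem (CoxeterMatrix.A n) W) :
    -- descent sets from the canonical form
    (∀ (p : ℕ) (i j : Fin p → Fin n), FCDiagram.IsStandard i j →
      ∀ w : W, w = cs.wordProd (FCDiagram.canonicalWord i j) →
        FCDiagram.leftDescents cs w =
            {s | ∃ k : Fin p, (k : ℕ) = 0 ∧ s = i k} ∪
            {s | ∃ k l : Fin p, (k : ℕ) = (l : ℕ) + 1 ∧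
              ((i k : ℕ) : ℤ) < ((i l : ℕ) : ℤ) - 1 ∧ s = i k} ∧
        FCDiagram.rightDescents cs w =
            {s | ∃ k : Fin p, (k : ℕ) + 1 = p ∧ s = j k} ∪
            {s | ∃ k l : Fin p, (l : ℕ) = (k : ℕ) + 1 ∧
              ((j l : ℕ) : ℤ) + 1 < ((j k : ℕ) : ℤ) ∧ s = j k}) ∧
    -- descent sets from the diagram, which is non-crossing and can be computed from any
    -- reduced expression
    (∀ w : W, FCDiagram.IsFullyCommutative cs w →
      FCDiagram.IsNonCrossingDiagram (FCDiagram.diagram cs w) ∧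
      (∀ ω : List (Fin n), cs.IsReduced ω → cs.wordProd ω = w →
        FCDiagram.wordDiagram ω = FCDiagram.diagram cs w) ∧
      FCDiagram.leftDescents cs w =
        {s | (FCDiagram.top s.castSucc, FCDiagram.top s.succ) ∈
          FCDiagram.topArrows (FCDiagram.diagram cs w)} ∧
      FCDiagram.rightDescents cs w =
        {s | (FCDiagram.bot s.castSucc, FCDiagram.bot s.succ) ∈
          FCDiagram.bottomArrows (FCDiagram.diagram cs w)}) := by
  refine ⟨?_, fun w hw => ?_⟩
  · rintro p i j h _ rfl
    exact ⟨h.leftDescents_eq, h.rightDescents_eq⟩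
  · exact ⟨FCDiagram.isNonCrossingDiagram_wordDiagram _,
      fun _ hω hprod => hw.wordDiagram_eq_diagram hω hprod,
      hw.leftDescents_eq, hw.rightDescents_eq⟩
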